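/- Let $F$ be a finite field with $q$ elements, of odd characteristic, let $E$ be its quadratic extension, with norm $N$ and trace $\mathrm{Tr}$ from $E$ to $F$, and put $G=\mathrm{GL}(2,F)$. Fix an $F$-basis $(b_0,b_1)$ of $E$ with $\mathrm{Tr}(b_1/b_0)=0$ (for instance $(1,\sqrt t)$ with $t\in F^\times$ a non-square), let $m_z\in G$ be the matrix of $w\mapsto zw$ in this basis, and let $K=\{m_z: z\in E^\times\}$ be the Coxeter torus. A character $\Phi$ of $E^\times$ is also viewed as the character $m_z\mapsto\Phi(z)$ of $K$. Let $\Phi,\Lambda$ be complex characters of $E^\times$ with $\Lambda^q\ne\Lambda$, and let $\phi,\lambda$ be their restrictions to $F^\times$. Let $\chi^{q-1}_\Lambda$ be the character of the irreducible cuspidal representation of $G$ of dimension $q-1$ attached to $\Lambda$ (realized on the complex functions on $F^\times$ by its Kirillov model with respect to any nontrivial additive character $\psi$ of $F$). Define the twisted spherical function associated to $\chi^{q-1}_\Lambda$ by $$\zeta^\Phi_\Lambda(g)=\frac1{|K|}\sum_{k\in K}\Phi^{-1}(k)\,\chi^{q-1}_\Lambda(kg)\qquad(g\in G).$$ For $a\in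 F^\times$ let $d(a,1)=\begin{pmatrix}a&0\\0&1\end{pmatrix}$, let $$\Gamma_a=\{(z,w)\in E^\times\times E^\times:\ N(w)=a\,N(z),\ \mathrm{Tr}(w)=2^{-1}(a+1)\,\mathrm{Tr}(z)\},$$ and put $$S^\Phi_\Lambda(a)=-(q^2-1)^{-1}\sum_{(z,w)\in\Gamma_a}\Phi^{-1}(z)\Lambda(w).$$ Then $\zeta^\Phi_\Lambda(kgk')=\Phi(k)\,\zeta^\Phi_\Lambda(g)\,\Phi(k')$ for all $g\in G$ and $k,k'\in K$, so that on each double coset $K\,d(a,1)\,K$ the function is determined by its value at the representative $d(a,1)$, and for every $a\in F^\times$ $$\zeta^\Phi_\Lambda(d(a,1))=S^\Phi_\Lambda(a)+q(q+1)^{-1}\,\delta_{a,1}\,\delta_{\lambda,\phi},$$ where $\delta_{a,1}$ is $1$ if $a=1$ and $0$ otherwise, and $\delta_{\lambda,\phi}$ is $1$ if $\lambda=\phi$ and $0$ otherwise. -/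

import Mathlib

namespace TwistedSpherical

section QuadraticExtension

set_option linter.unusedSectionVars false

variable {F E : Type*} [Field F] [Fintype F] [Field E] [Fintype E] [Algebra F E]

theorem algebraMap_norm_eq (hE : Module.finrank F E = 2) (x : E) :
    algebraMap F E (Algebra.norm F x) = x * FiniteField.frobeniusAlgHom F E x := by
  rw [FiniteField.algebraMap_norm_eq_prod_pow, hE]
  simp [Finset.prod_range_succ]

theorem algebraMap_trace_eq (hE : Module.finrank F E = 2) (x : E) :
    algebraMap F E (Algebra.trace F E x) = x + FiniteField.frobeniusAlgHom F E x := by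
  rw [FiniteField.algebraMap_trace_eq_sum_pow, hE]
  simp [Finset.sum_range_succ]

theorem card_quadratic (hE : Module.finrank F E = 2) :
    Fintype.card E = Fintype.card F ^ 2 := by
  rw [← hE]; exact Module.card_eq_pow_finrank

theorem conj_conj (hE : Module.finrank F E = 2) (x : E) :
    FiniteField.frobeniusAlgHom F E (FiniteField.frobeniusAlgHom F E x) = x := by
  simp only [FiniteField.coe_frobeniusAlgHom]
  rw [← pow_mul, ← sq, ← card_quadratic hE, FiniteField.pow_card]

theorem sum_eq_zero_add_units {K : Type*} [Field K] [Fintype K] [Fintype Kˣ] (f : K → ℂ) :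
    ∑ s, f s = f 0 + ∑ s : Kˣ, f s := by
  classical
  rw [Fintype.sum_eq_add_sum_subtype_ne f 0]
  congr 1
  exact (Fintype.sum_equiv unitsEquivNeZero (fun s : Kˣ => f s) (fun s => f s.1)
    (fun _ => rfl)).symm

/-- Linear exponential sums over the quadratic extension. -/
theorem sum_trace (hE : Module.finrank F E = 2) {ψ : AddChar F ℂ} (hψ : ψ ≠ 1)
    [DecidableEq E] (β : E) :
    ∑ s : E, ψ (-Algebra.trace F E (s * FiniteField.frobeniusAlgHom F E β)) =
      if β = 0 then (Fintype.card F : ℂ) ^ 2 else 0 := by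
  split_ifs with h
  · simp [h, card_quadratic hE]
  · let χ : AddChar E ℂ := ψ.compAddMonoidHom (-((Algebra.trace F E).toAddMonoidHom.comp
      (AddMonoidHom.mulRight (FiniteField.frobeniusAlgHom F E β))))
    have hχ : χ ≠ 1 := by
      obtain ⟨x, hx⟩ := AddChar.ne_one_iff.1 hψ
      obtain ⟨y, hy⟩ := Algebra.trace_surjective F E (-x)
      have hβ : FiniteField.frobeniusAlgHom F E β ≠ 0 := by simpa using h
      refine AddChar.ne_one_iff.2 ⟨y / FiniteField.frobeniusAlgHom F E β, ?_⟩
      simp only [χ, AddChar.compAddMonoidHom_apply, AddMonoidHom.neg_apply,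
        AddMonoidHom.comp_apply, AddMonoidHom.coe_mulRight]
      rw [div_mul_cancel₀ _ hβ]
      simpa [hy] using hx
    exact AddChar.sum_eq_zero_of_ne_one hχ

/-- The exponential sum of the norm form over the quadratic extension. -/
theorem sum_norm (hE : Module.finrank F E = 2) {ψ : AddChar F ℂ} (hψ : ψ ≠ 1) {A : F}
    (hA : A ≠ 0) :
    ∑ s : E, ψ (A * Algebra.norm F s) = -(Fintype.card F : ℂ) := by
  classical
  rw [sum_eq_zero_add_units]
  let N : Eˣ →* Fˣ := Units.map (Algebra.norm F)
  have hN : Function.Surjective N := FiniteField.unitsMap_norm_surjective F E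
  have hq : 1 < Fintype.card F := Fintype.one_lt_card
  have hfib : ∀ y : Fˣ, (Finset.univ.filter fun s : Eˣ => N s = y).card
      = Fintype.card F + 1 := by
    have hsame : ∀ y : Fˣ, (Finset.univ.filter fun s : Eˣ => N s = y).card =
        (Finset.univ.filter fun s : Eˣ => N s = 1).card := fun y =>
      MonoidHom.card_fiber_eq_of_mem_range N (hN y) (hN 1)
    have htot : Fintype.card Eˣ = ∑ y : Fˣ, (Finset.univ.filter fun s : Eˣ => N s = y).card :=
      Finset.card_eq_sum_card_fiberwise (fun _ _ => Finset.mem_univ _)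
    simp_rw [hsame] at htot
    rw [Finset.sum_const, smul_eq_mul, Finset.card_univ, Fintype.card_units,
      Fintype.card_units, card_quadratic hE] at htot
    have h2 : Fintype.card F ^ 2 - 1 = (Fintype.card F - 1) * (Fintype.card F + 1) := by
      have := Nat.sq_sub_sq (Fintype.card F) 1
      rw [one_pow] at this
      rw [this, mul_comm]
    rw [h2] at htot
    intro y
    rw [hsame y]
    exact (Nat.eq_of_mul_eq_mul_left (by omega) htot).symm
  have h1 : ∑ s : Eˣ, ψ (A * Algebra.norm F (s : E)) =
      ∑ y : Fˣ, ((Fintype.card F : ℂ) + 1) * ψ (A * y) := by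
    rw [← Finset.sum_fiberwise (s := Finset.univ) (g := N)]
    refine Finset.sum_congr rfl fun y _ => ?_
    rw [Finset.sum_congr rfl (g := fun _ => ψ (A * y))]
    · rw [Finset.sum_const, hfib y]; simp
    · intro s hs
      rw [← (Finset.mem_filter.1 hs).2]; rfl
  have h2 : ∑ y : F, ψ (A * y) = 0 := by
    have := AddChar.sum_mulShift (ψ := ψ) A (AddChar.IsPrimitive.of_ne_one hψ)
    simpa [hA, mul_comm] using this
  rw [sum_eq_zero_add_units] at h2
  rw [h1, ← Finset.mul_sum]
  simp only [mul_zero, AddChar.map_zero_eq_one, Algebra.norm_zero] at h2 ⊢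
  linear_combination ((Fintype.card F : ℂ) + 1) * h2

/-- Quadratic exponential sums over the quadratic extension, by completing the square. -/
theorem sum_quadratic (hE : Module.finrank F E = 2) {ψ : AddChar F ℂ} (hψ : ψ ≠ 1) {A : F}
    (hA : A ≠ 0) (β : E) :
    ∑ s : E, ψ (A * Algebra.norm F s
        - Algebra.trace F E (s * FiniteField.frobeniusAlgHom F E β)) =
      -(Fintype.card F : ℂ) * ψ (-(Algebra.norm F β / A)) := by
  have key : ∀ s : E, A * Algebra.norm F s
      - Algebra.trace F E (s * FiniteField.frobeniusAlgHom F E β) =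
      A * Algebra.norm F (s - β / algebraMap F E A) + -(Algebra.norm F β / A) := by
    intro s
    apply (algebraMap F E).injective
    have hA' : algebraMap F E A ≠ 0 := by simpa using hA
    simp only [map_sub, map_mul, map_add, map_neg, map_div₀, algebraMap_norm_eq hE,
      algebraMap_trace_eq hE, conj_conj hE, AlgHom.commutes]
    field_simp
    ring
  simp_rw [key, AddChar.map_add_eq_mul]
  rw [← Finset.sum_mul]
  congr 1
  rw [← sum_norm hE hψ hA]
  exact Fintype.sum_equiv (Equiv.subRight (β / algebraMap F E A)) _ _ fun _ => rfl

/-- A character that differs from its Frobenius twist sums to zero over each norm fibre. -/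
theorem sum_norm_fibre {Λ : MulChar E ℂ}
    (hΛ : Λ ^ Fintype.card F ≠ Λ) [DecidableEq F] [Fintype Eˣ] (n : Fˣ) :
    ∑ t : Eˣ, (if Units.map (Algebra.norm F) t = n then Λ t else 0) = 0 := by
  classical
  obtain ⟨v, hv⟩ : ∃ v : Eˣ, Λ (v : E) ^ Fintype.card F ≠ Λ (v : E) := by
    by_contra! h
    exact hΛ (MulChar.ext fun v => by rw [MulChar.pow_apply_coe]; exact h v)
  let u : Eˣ := v ^ Fintype.card F * v⁻¹
  have hNu : Units.map (Algebra.norm F) u = 1 := by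
    have : ∀ y : Fˣ, y ^ Fintype.card F = y := fun y => Units.ext (by simp [FiniteField.pow_card])
    simp only [u, map_mul, map_pow, map_inv, this, mul_inv_cancel]
  have hv0 : Λ (v : E) ≠ 0 := (v.isUnit.map Λ).ne_zero
  have hΛu : Λ (u : E) ≠ 1 := by
    intro h
    apply hv
    have : u * v = v ^ Fintype.card F := by simp [u]
    have := congrArg (fun z : Eˣ => Λ (z : E)) this
    simpa [h] using this.symm
  refine eq_zero_of_mul_eq_self_left hΛu ?_
  rw [Finset.mul_sum]
  refine Fintype.sum_equiv (Equiv.mulLeft u) _ _ fun t => ?_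
  simp only [Equiv.coe_mulLeft, map_mul, hNu, one_mul, Units.val_mul, mul_ite, mul_zero]

end QuadraticExtension

section CuspidalRepresentation

set_option linter.unusedSectionVars false

variable {F E : Type*} [Field F] [Fintype F] [Field E] [Fintype E] [Algebra F E]

open Classical in
/-- The sum of `ψ(-Tr(t)/c) Λ(t)` over all `t` in `Eˣ` of norm `n`. -/
noncomputable def normFibreSum (ψ : AddChar F ℂ) (Λ : MulChar E ℂ) (c : F) (n : Fˣ) : ℂ :=
  ∑ t : Eˣ, if Units.map (Algebra.norm F) t = n then
    ψ (-(Algebra.trace F E t / c)) * Λ t else 0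

open Classical in
/-- The kernel `k(x, y)` of the operator by which the matrix with rows `(a, b)`, `(c, d)` and
determinant `D` acts in the Kirillov model of the cuspidal representation attached to `Λ`:
for `c = 0` the operator is `f ↦ (x ↦ Λ(d) ψ(b x / d) f(a x / d))`, and for `c ≠ 0` its kernel is
`-q⁻¹ ψ((a x + d y) / c) Λ(y)⁻¹ ∑ ψ(-Tr(t) / c) Λ(t)`, summed over `t` in `Eˣ` with
`N(t) = x y D`. -/
noncomputable def cuspidalKernel (ψ : AddChar F ℂ) (Λ : MulChar E ℂ) (a b c d : F)
    (D x y : Fˣ) : ℂ :=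
  if c = 0 then
    if d * y = a * x then Λ (algebraMap F E d) * ψ (b * x / d) else 0
  else
    -(Fintype.card F : ℂ)⁻¹ * ψ ((a * x + d * y) / c) * (Λ (algebraMap F E y))⁻¹ *
      normFibreSum ψ Λ c (x * y * D)

theorem normFibreSum_scale (hE : Module.finrank F E = 2) (ψ : AddChar F ℂ) (Λ : MulChar E ℂ)
    (c : F) (n m u : Fˣ) (hm : m = u ^ 2 * n) :
    normFibreSum ψ Λ (u * c) m = Λ (algebraMap F E u) * normFibreSum ψ Λ c n := by
  classical
  subst hm
  unfold normFibreSum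
  rw [Finset.mul_sum]
  let w : Eˣ := Units.map (algebraMap F E) u
  have hNw : Units.map (Algebra.norm F) w = u ^ 2 := by
    apply Units.ext
    simp [w, Algebra.norm_algebraMap, hE]
  refine (Fintype.sum_equiv (Equiv.mulLeft w) _ _ fun t => ?_).symm
  have h1 : (Units.map (Algebra.norm F) (w * t) = u ^ 2 * n) ↔
      Units.map (Algebra.norm F) t = n := by rw [map_mul, hNw, mul_right_inj]
  have h2 : Algebra.trace F E ((w * t : Eˣ) : E) = u * Algebra.trace F E (t : E) := by
    have : ((w * t : Eˣ) : E) = (u : F) • (t : E) := by simp [w, Algebra.smul_def]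
    rw [this, map_smul, smul_eq_mul]
  have h3 : Λ ((w * t : Eˣ) : E) = Λ (algebraMap F E u) * Λ t := by
    rw [Units.val_mul, map_mul]; rfl
  simp only [Equiv.coe_mulLeft, h1, h2, h3, mul_div_mul_left _ _ u.ne_zero]
  split_ifs
  · ring
  · simp

theorem map_algebraMap_ne_zero (Λ : MulChar E ℂ) {a : F} (ha : a ≠ 0) :
    Λ (algebraMap F E a) ≠ 0 :=
  ((IsUnit.mk0 a ha).map (algebraMap F E) |>.map Λ).ne_zero

theorem cuspidalKernel_mul_of_left [Fintype Fˣ] (hE : Module.finrank F E = 2)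
    (ψ : AddChar F ℂ) (Λ : MulChar E ℂ)
    {a₁ b₁ d₁ a₂ b₂ c₂ d₂ : F} {D₁ D₂ : Fˣ} (h₁ : (D₁ : F) = a₁ * d₁)
    (h₂ : (D₂ : F) = a₂ * d₂ - b₂ * c₂) (x z : Fˣ) :
    ∑ y : Fˣ, cuspidalKernel ψ Λ a₁ b₁ 0 d₁ D₁ x y * cuspidalKernel ψ Λ a₂ b₂ c₂ d₂ D₂ y z =
      cuspidalKernel ψ Λ (a₁ * a₂ + b₁ * c₂) (a₁ * b₂ + b₁ * d₂) (d₁ * c₂) (d₁ * d₂)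
        (D₁ * D₂) x z := by
  classical
  have ha₁ : a₁ ≠ 0 := by rintro rfl; exact D₁.ne_zero (by simp [h₁])
  have hd₁ : d₁ ≠ 0 := by rintro rfl; exact D₁.ne_zero (by simp [h₁])
  obtain ⟨u, rfl⟩ : ∃ u : Fˣ, (u : F) = d₁ := ⟨Units.mk0 d₁ hd₁, rfl⟩
  obtain ⟨v, rfl⟩ : ∃ v : Fˣ, (v : F) = a₁ := ⟨Units.mk0 a₁ ha₁, rfl⟩
  have hD : D₁ = v * u := Units.ext h₁
  subst hD
  have hxy : ∀ y : Fˣ, (u : F) * y = v * x ↔ y = u⁻¹ * v * x := by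
    intro y
    rw [mul_assoc, eq_inv_mul_iff_mul_eq, Units.ext_iff]
    simp
  rw [Finset.sum_eq_single (u⁻¹ * v * x)]
  rotate_left
  · intro y _ hy
    have : ¬ ((u : F) * y = v * x) := fun h => hy ((hxy y).1 h)
    simp [cuspidalKernel, this]
  · intro h; exact absurd (Finset.mem_univ _) h
  have e1 : cuspidalKernel ψ Λ v b₁ 0 u (v * u) x (u⁻¹ * v * x) =
      Λ (algebraMap F E u) * ψ (b₁ * x / u) := by
    simp only [cuspidalKernel, if_true, if_pos ((hxy (u⁻¹ * v * x)).2 rfl)]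
  rw [e1]
  have hu := u.ne_zero
  have hx := x.ne_zero
  by_cases hc : c₂ = 0
  · subst hc
    have hd₂ : d₂ ≠ 0 := by rintro rfl; exact D₂.ne_zero (by simp [h₂])
    simp only [cuspidalKernel, mul_zero, add_zero, if_true, Units.val_mul,
      Units.val_inv_eq_inv_val]
    have : (d₂ * (z : F) = a₂ * ((u : F)⁻¹ * v * x)) ↔ (u * d₂ * z = v * a₂ * x) := by
      field_simp
    simp only [this]
    split_ifs with h
    · simp only [map_mul]
      have : (v * b₂ + b₁ * d₂) * (x : F) / (u * d₂) =
        b₁ * x / u + b₂ * ((u : F)⁻¹ * v * x) / d₂ := by field_simp; ring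
      rw [this, AddChar.map_add_eq_mul]; ring
    · simp
  · have hc' : (u : F) * c₂ ≠ 0 := mul_ne_zero hu hc
    simp only [cuspidalKernel, if_neg hc, if_neg hc']
    rw [normFibreSum_scale hE ψ Λ c₂ (u⁻¹ * v * x * z * D₂) (x * z * (v * u * D₂)) u
      (Units.ext (by simp; field_simp))]
    have : ((v * a₂ + b₁ * c₂) * (x : F) + u * d₂ * z) / (u * c₂) =
        b₁ * x / u + (a₂ * ((u⁻¹ * v * x : Fˣ) : F) + d₂ * z) / c₂ := by
      simp only [Units.val_mul, Units.val_inv_eq_inv_val]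
      field_simp
      ring
    rw [this, AddChar.map_add_eq_mul]
    ring

theorem cuspidalKernel_mul_of_right [Fintype Fˣ] (hE : Module.finrank F E = 2)
    (ψ : AddChar F ℂ) (Λ : MulChar E ℂ)
    {a₁ b₁ c₁ d₁ a₂ b₂ d₂ : F} {D₁ D₂ : Fˣ} (hc : c₁ ≠ 0)
    (h₂ : (D₂ : F) = a₂ * d₂) (x z : Fˣ) :
    ∑ y : Fˣ, cuspidalKernel ψ Λ a₁ b₁ c₁ d₁ D₁ x y * cuspidalKernel ψ Λ a₂ b₂ 0 d₂ D₂ y z =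
      cuspidalKernel ψ Λ (a₁ * a₂) (a₁ * b₂ + b₁ * d₂) (c₁ * a₂) (c₁ * b₂ + d₁ * d₂)
        (D₁ * D₂) x z := by
  classical
  have ha₁ : a₂ ≠ 0 := by rintro rfl; exact D₂.ne_zero (by simp [h₂])
  have hd₁ : d₂ ≠ 0 := by rintro rfl; exact D₂.ne_zero (by simp [h₂])
  obtain ⟨u, rfl⟩ : ∃ u : Fˣ, (u : F) = d₂ := ⟨Units.mk0 d₂ hd₁, rfl⟩
  obtain ⟨v, rfl⟩ : ∃ v : Fˣ, (v : F) = a₂ := ⟨Units.mk0 a₂ ha₁, rfl⟩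
  have hD : D₂ = v * u := Units.ext h₂
  subst hD
  have hxy : ∀ y : Fˣ, (u : F) * z = v * y ↔ y = v⁻¹ * u * z := by
    intro y
    rw [mul_assoc, eq_inv_mul_iff_mul_eq, Units.ext_iff]
    simp [eq_comm]
  rw [Finset.sum_eq_single (v⁻¹ * u * z)]
  rotate_left
  · intro y _ hy
    have : ¬ ((u : F) * z = v * y) := fun h => hy ((hxy y).1 h)
    simp [cuspidalKernel, this]
  · intro h; exact absurd (Finset.mem_univ _) h
  have hu := u.ne_zero
  have hv := v.ne_zero
  have hc' : c₁ * (v : F) ≠ 0 := mul_ne_zero hc hv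
  simp only [cuspidalKernel, if_true, if_pos ((hxy (v⁻¹ * u * z)).2 rfl), if_neg hc, if_neg hc']
  rw [mul_comm c₁ (v : F),
    normFibreSum_scale hE ψ Λ c₁ (x * (v⁻¹ * u * z) * D₁) (x * z * (D₁ * (v * u))) v
      (Units.ext (by simp; field_simp))]
  have : (a₁ * v * (x : F) + (c₁ * b₂ + d₁ * u) * z) / (v * c₁) =
      (a₁ * x + d₁ * ((v⁻¹ * u * z : Fˣ) : F)) / c₁ + b₂ * ((v⁻¹ * u * z : Fˣ) : F) / u := by
    simp only [Units.val_mul, Units.val_inv_eq_inv_val]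
    field_simp
    ring
  rw [this, AddChar.map_add_eq_mul]
  have hΛ : Λ (algebraMap F E ((v⁻¹ * u * z : Fˣ) : F)) * Λ (algebraMap F E v) =
      Λ (algebraMap F E u) * Λ (algebraMap F E z) := by
    rw [← map_mul, ← map_mul, ← map_mul, ← map_mul]
    congr 2
    simp only [Units.val_mul, Units.val_inv_eq_inv_val]
    field_simp
  have n1 := map_algebraMap_ne_zero Λ (v⁻¹ * u * z).ne_zero
  have n2 := map_algebraMap_ne_zero Λ z.ne_zero
  have hinv : (Λ (algebraMap F E ((v⁻¹ * u * z : Fˣ) : F)))⁻¹ * Λ (algebraMap F E u) =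
      Λ (algebraMap F E v) * (Λ (algebraMap F E z))⁻¹ := by
    field_simp
    linear_combination -hΛ
  linear_combination (-(Fintype.card F : ℂ)⁻¹ *
    ψ ((a₁ * x + d₁ * ((v⁻¹ * u * z : Fˣ) : F)) / c₁) *
    ψ (b₂ * ((v⁻¹ * u * z : Fˣ) : F) / u) *
    normFibreSum ψ Λ c₁ (x * (v⁻¹ * u * z) * D₁)) * hinv

open Classical in
theorem sum_normFibreSum_mul [Fintype Fˣ]
    (hE : Module.finrank F E = 2)
    (ψ : AddChar F ℂ) (Λ : MulChar E ℂ) (e c₁ c₂ : F) (D₁ D₂ x z : Fˣ) :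
    ∑ y : Fˣ, ψ (e * y) * (Λ (algebraMap F E y))⁻¹ *
        (normFibreSum ψ Λ c₁ (x * y * D₁) * normFibreSum ψ Λ c₂ (y * z * D₂)) =
      ∑ r : Eˣ, if Units.map (Algebra.norm F) r = x * z * (D₁ * D₂) then
        Λ r * ∑ s : Eˣ, ψ (e / (x * D₁) * Algebra.norm F (s : E) -
          Algebra.trace F E (s * FiniteField.frobeniusAlgHom F E
            (algebraMap F E c₁⁻¹ + r * algebraMap F E (c₂ * x * D₁)⁻¹))) else 0 := by
  classical
  have lhs : ∀ y : Fˣ, ψ (e * y) * (Λ (algebraMap F E y))⁻¹ *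
        (normFibreSum ψ Λ c₁ (x * y * D₁) * normFibreSum ψ Λ c₂ (y * z * D₂)) =
      ∑ s : Eˣ, if y = Units.map (Algebra.norm F) s * (x * D₁)⁻¹ then
        ψ (e * y) * (Λ (algebraMap F E y))⁻¹ * (ψ (-(Algebra.trace F E s / c₁)) * Λ s *
          normFibreSum ψ Λ c₂ (y * z * D₂)) else 0 := by
    intro y
    rw [normFibreSum, Finset.sum_mul, Finset.mul_sum]
    refine Finset.sum_congr rfl fun s _ => ?_
    have : (Units.map (Algebra.norm F) s = x * y * D₁) ↔
        y = Units.map (Algebra.norm F) s * (x * D₁)⁻¹ := by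
      rw [eq_mul_inv_iff_mul_eq, eq_comm, mul_right_comm, mul_comm (x * D₁) y]
    simp only [this]
    by_cases h : y = Units.map (Algebra.norm F) s * (x * D₁)⁻¹
    · simp only [if_pos h]
    · simp only [if_neg h, zero_mul, mul_zero]
  simp_rw [lhs]
  rw [Finset.sum_comm]
  simp only [Finset.sum_ite_eq', Finset.mem_univ, if_true]
  have rhs : (∑ r : Eˣ, if Units.map (Algebra.norm F) r = x * z * (D₁ * D₂) then
        Λ r * ∑ s : Eˣ, ψ (e / (x * D₁) * Algebra.norm F (s : E) -
          Algebra.trace F E (s * FiniteField.frobeniusAlgHom F E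
            (algebraMap F E c₁⁻¹ + r * algebraMap F E (c₂ * x * D₁)⁻¹))) else 0) =
      ∑ s : Eˣ, ∑ r : Eˣ, if Units.map (Algebra.norm F) r = x * z * (D₁ * D₂) then
        Λ r * ψ (e / (x * D₁) * Algebra.norm F (s : E) -
          Algebra.trace F E (s * FiniteField.frobeniusAlgHom F E
            (algebraMap F E c₁⁻¹ + r * algebraMap F E (c₂ * x * D₁)⁻¹))) else 0 := by
    rw [Finset.sum_comm]
    refine Finset.sum_congr rfl fun r _ => ?_
    split_ifs
    · rw [Finset.mul_sum]
    · simp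
  rw [rhs]
  refine Finset.sum_congr rfl fun s _ => ?_
  set y : Fˣ := Units.map (Algebra.norm F) s * (x * D₁)⁻¹ with hy
  have hNs : Units.map (Algebra.norm F) s = y * (x * D₁) := by
    rw [hy, inv_mul_cancel_right]
  have hNs' : Algebra.norm F (s : E) = y * (x * D₁) := congrArg Units.val hNs
  let w : Eˣ := Units.map (algebraMap F E) y * s⁻¹
  have hw : (w : E) = algebraMap F E y * (s : E)⁻¹ := by simp [w]
  have hNw : Units.map (Algebra.norm F) w = y * (x * D₁)⁻¹ := by
    have : Units.map (Algebra.norm F) (Units.map (algebraMap F E : F →* E) y) = y ^ 2 := by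
      apply Units.ext
      simp [Algebra.norm_algebraMap, hE]
    rw [map_mul, map_inv, this, hNs, mul_inv, sq, mul_assoc, mul_inv_cancel_left]
  rw [normFibreSum, Finset.mul_sum, Finset.mul_sum]
  refine (Fintype.sum_equiv (Equiv.mulLeft w) _ _ fun r => ?_).symm
  have hcond : (Units.map (Algebra.norm F) (w * r) = y * z * D₂) ↔
      (Units.map (Algebra.norm F) r = x * z * (D₁ * D₂)) := by
    rw [map_mul, hNw, mul_assoc y, mul_assoc y, mul_right_inj, inv_mul_eq_iff_eq_mul]
    rw [show x * D₁ * (z * D₂) = x * z * (D₁ * D₂) from mul_mul_mul_comm _ _ _ _]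
  simp only [Equiv.coe_mulLeft, hcond]
  by_cases h : Units.map (Algebra.norm F) r = x * z * (D₁ * D₂)
  swap
  · simp only [if_neg h, mul_zero]
  simp only [if_pos h]
  have hs0 : (s : E) ≠ 0 := s.ne_zero
  have hΛs : Λ (s : E) ≠ 0 := (s.isUnit.map Λ).ne_zero
  have hΛy := map_algebraMap_ne_zero (E := E) Λ y.ne_zero
  have hΛw : Λ ((w * r : Eˣ) : E) * Λ (s : E) = Λ (algebraMap F E y) * Λ (r : E) := by
    rw [← map_mul, ← map_mul, Units.val_mul, hw]
    congr 1
    field_simp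
  have hexp : e / (x * D₁) * Algebra.norm F (s : E) -
          Algebra.trace F E (s * FiniteField.frobeniusAlgHom F E
            (algebraMap F E c₁⁻¹ + r * algebraMap F E (c₂ * x * D₁)⁻¹)) =
      e * y + (-(Algebra.trace F E (s : E) / c₁) +
        -(Algebra.trace F E ((w * r : Eˣ) : E) / c₂)) := by
    have hx := x.ne_zero
    have hD := D₁.ne_zero
    have h1 : e / (x * D₁) * Algebra.norm F (s : E) = e * y := by
      rw [hNs']; field_simp
    have h2 : Algebra.trace F E (s * FiniteField.frobeniusAlgHom F E
            (algebraMap F E c₁⁻¹ + r * algebraMap F E (c₂ * x * D₁)⁻¹)) =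
        Algebra.trace F E (s : E) / c₁ + Algebra.trace F E ((w * r : Eˣ) : E) / c₂ := by
      apply (algebraMap F E).injective
      have hyE : algebraMap F E y = s * FiniteField.frobeniusAlgHom F E s *
          (algebraMap F E (x * D₁))⁻¹ := by
        rw [← algebraMap_norm_eq hE, hNs', map_mul, mul_assoc, mul_inv_cancel₀, mul_one]
        simp
      have hwr : ((w * r : Eˣ) : E) = FiniteField.frobeniusAlgHom F E s * r *
          (algebraMap F E (x * D₁))⁻¹ := by
        rw [Units.val_mul, hw, hyE]
        field_simp
      rw [hwr]
      simp only [map_mul, map_add, map_div₀, map_inv₀,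
        algebraMap_trace_eq hE, conj_conj hE, AlgHom.commutes]
      field_simp
      ring
    rw [h1, h2]; ring
  rw [hexp, AddChar.map_add_eq_mul, AddChar.map_add_eq_mul]
  have : Λ (r : E) = (Λ (algebraMap F E y))⁻¹ * (Λ ((w * r : Eˣ) : E) * Λ (s : E)) := by
    rw [hΛw, inv_mul_cancel_left₀ hΛy]
  rw [this]
  ring

theorem cuspidalKernel_mul_of_ne_zero [Fintype Fˣ] (hE : Module.finrank F E = 2)
    {ψ : AddChar F ℂ} (hψ : ψ ≠ 1) {Λ : MulChar E ℂ} (hΛ : Λ ^ Fintype.card F ≠ Λ)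
    {a₁ b₁ c₁ d₁ a₂ b₂ c₂ d₂ : F} {D₁ D₂ : Fˣ} (hc₁ : c₁ ≠ 0) (hc₂ : c₂ ≠ 0)
    (h₁ : (D₁ : F) = a₁ * d₁ - b₁ * c₁) (h₂ : (D₂ : F) = a₂ * d₂ - b₂ * c₂) (x z : Fˣ) :
    ∑ y : Fˣ, cuspidalKernel ψ Λ a₁ b₁ c₁ d₁ D₁ x y *
        cuspidalKernel ψ Λ a₂ b₂ c₂ d₂ D₂ y z =
      cuspidalKernel ψ Λ (a₁ * a₂ + b₁ * c₂) (a₁ * b₂ + b₁ * d₂) (c₁ * a₂ + d₁ * c₂)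
        (c₁ * b₂ + d₁ * d₂) (D₁ * D₂) x z := by
  classical
  set q : ℂ := (Fintype.card F : ℂ) with hq
  have hq0 : q ≠ 0 := by simp [hq]
  set e : F := d₁ / c₁ + a₂ / c₂ with he
  have hx := x.ne_zero
  have hz := z.ne_zero
  have hD₁ := D₁.ne_zero
  have hD₂ := D₂.ne_zero
  have step1 : ∑ y : Fˣ, cuspidalKernel ψ Λ a₁ b₁ c₁ d₁ D₁ x y *
        cuspidalKernel ψ Λ a₂ b₂ c₂ d₂ D₂ y z =
      q⁻¹ ^ 2 * ψ (a₁ * x / c₁ + d₂ * z / c₂) * (Λ (algebraMap F E z))⁻¹ *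
      ∑ y : Fˣ, ψ (e * y) * (Λ (algebraMap F E y))⁻¹ *
        (normFibreSum ψ Λ c₁ (x * y * D₁) * normFibreSum ψ Λ c₂ (y * z * D₂)) := by
    rw [Finset.mul_sum]
    refine Finset.sum_congr rfl fun y _ => ?_
    simp only [cuspidalKernel, if_neg hc₁, if_neg hc₂]
    have : ψ ((a₁ * x + d₁ * y) / c₁) * ψ ((a₂ * y + d₂ * z) / c₂) =
        ψ (a₁ * x / c₁ + d₂ * z / c₂) * ψ (e * y) := by
      rw [← AddChar.map_add_eq_mul, ← AddChar.map_add_eq_mul]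
      congr 1
      rw [he]; ring
    linear_combination (q⁻¹ ^ 2 * (Λ (algebraMap F E y))⁻¹ * (Λ (algebraMap F E z))⁻¹ *
      normFibreSum ψ Λ c₁ (x * y * D₁) * normFibreSum ψ Λ c₂ (y * z * D₂)) * this
  rw [step1, sum_normFibreSum_mul hE]
  set n : Fˣ := x * z * (D₁ * D₂) with hn
  let β : E → E := fun r => algebraMap F E c₁⁻¹ + r * algebraMap F E (c₂ * x * D₁)⁻¹
  -- extend the inner sum to all of `E`
  have step2 : (∑ r : Eˣ, if Units.map (Algebra.norm F) r = n then
        Λ r * ∑ s : Eˣ, ψ (e / (x * D₁) * Algebra.norm F (s : E) -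
          Algebra.trace F E (s * FiniteField.frobeniusAlgHom F E (β r))) else 0) =
      ∑ r : Eˣ, if Units.map (Algebra.norm F) r = n then
        Λ r * ∑ s : E, ψ (e / (x * D₁) * Algebra.norm F (s : E) -
          Algebra.trace F E (s * FiniteField.frobeniusAlgHom F E (β r))) else 0 := by
    rw [← sub_eq_zero, ← Finset.sum_sub_distrib, ← neg_eq_zero, ← Finset.sum_neg_distrib]
    rw [← sum_norm_fibre hΛ n]
    refine Finset.sum_congr rfl fun r _ => ?_
    split_ifs
    · rw [sum_eq_zero_add_units (K := E)]
      simp only [Algebra.norm_zero, zero_mul, mul_zero, map_zero, sub_zero,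
        AddChar.map_zero_eq_one]
      ring
    · simp
  rw [step2]
  set c₃ := c₁ * a₂ + d₁ * c₂ with hc₃
  have hee : e = c₃ / (c₁ * c₂) := by rw [he, hc₃]; field_simp; ring
  by_cases h3 : c₃ = 0
  · have he0 : e = 0 := by rw [hee, h3, zero_div]
    simp only [cuspidalKernel, if_pos h3, he0, zero_div, zero_mul, zero_sub, sum_trace hE hψ]
    let r₀ : F := -(c₂ * x * D₁ / c₁)
    have hr₀ : r₀ ≠ 0 := by
      simp only [r₀, ne_eq, neg_eq_zero, div_eq_zero_iff, mul_eq_zero]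
      tauto
    let R : Eˣ := Units.map (algebraMap F E) (Units.mk0 r₀ hr₀)
    have hR : (R : E) = algebraMap F E r₀ := rfl
    have hβ : ∀ r : Eˣ, β r = 0 ↔ r = R := by
      intro r
      have hC : algebraMap F E (c₂ * x * D₁) ≠ 0 := by simp [hc₂]
      have hc₁' : algebraMap F E c₁ ≠ 0 := by simpa using hc₁
      rw [Units.ext_iff, hR]
      simp only [β, r₀, map_neg, map_div₀, map_inv₀]
      constructor
      · intro h
        field_simp at h ⊢
        linear_combination h
      · intro h
        rw [h]
        field_simp
        ring
    have hNR : (Units.map (Algebra.norm F) R = n) ↔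
        ((c₁ * b₂ + d₁ * d₂) * (z : F) = (a₁ * a₂ + b₁ * c₂) * x) := by
      have : Algebra.norm F (R : E) = r₀ ^ 2 := by
        rw [hR, Algebra.norm_algebraMap, hE]
      rw [Units.ext_iff, Units.coe_map]
      change Algebra.norm F (R : E) = (n : F) ↔ _
      rw [this]
      simp only [hn, Units.val_mul, r₀]
      have e1 : c₁ * (c₁ * b₂ + d₁ * d₂) * c₂ = -(c₁ ^ 2 * (D₂ : F)) := by
        rw [h₂]; linear_combination d₂ * c₁ * h3
      have e2 : c₁ * (a₁ * a₂ + b₁ * c₂) = - c₂ * (D₁ : F) := by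
        rw [h₁]; linear_combination a₁ * h3
      have hcc : c₁ * c₂ ≠ 0 := mul_ne_zero hc₁ hc₂
      rw [neg_sq, div_pow, div_eq_iff (pow_ne_zero 2 hc₁)]
      constructor
      · intro h
        have h' : c₂ ^ 2 * x * D₁ = z * D₂ * c₁ ^ 2 := by
          apply mul_left_cancel₀ (mul_ne_zero hx hD₁)
          linear_combination h
        apply mul_left_cancel₀ hcc
        linear_combination z * e1 - c₂ * x * e2 + h'
      · intro h
        linear_combination (x * D₁) * (c₂ * x * e2 - z * e1 + c₁ * c₂ * h)
    rw [Finset.sum_eq_single R]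
    rotate_left
    · intro r _ hr
      rw [if_neg (fun h => hr ((hβ r).1 h))]
      simp
    · intro h; exact absurd (Finset.mem_univ _) h
    rw [if_pos ((hβ R).2 rfl)]
    simp only [hNR]
    split_ifs with h
    swap
    · simp
    have hd₃ : c₁ * (c₁ * b₂ + d₁ * d₂) * c₂ = -(c₁ ^ 2 * (D₂ : F)) := by
      rw [h₂]; linear_combination d₂ * c₁ * h3
    have hd₃' : c₂ * (c₁ * b₂ + d₁ * d₂) = -(c₁ * (D₂ : F)) := by
      apply mul_left_cancel₀ hc₁; linear_combination hd₃
    have ha₃ : c₁ * (a₁ * a₂ + b₁ * c₂) = - c₂ * (D₁ : F) := by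
      rw [h₁]; linear_combination a₁ * h3
    have hd₃0 : c₁ * b₂ + d₁ * d₂ ≠ 0 := by
      intro h0
      rw [h0, mul_zero] at hd₃'
      exact mul_ne_zero hc₁ hD₂ (by linear_combination hd₃')
    have hRΛ : Λ (R : E) = Λ (algebraMap F E (c₁ * b₂ + d₁ * d₂)) * Λ (algebraMap F E z) := by
      rw [hR, ← map_mul, ← map_mul, h]
      congr 2
      simp only [r₀]
      field_simp
      linear_combination -ha₃
    have hψe : a₁ * x / c₁ + d₂ * z / c₂ =
        (a₁ * b₂ + b₁ * d₂) * x / (c₁ * b₂ + d₁ * d₂) := by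
      rw [eq_div_iff hd₃0, div_add_div _ _ hc₁ hc₂, div_mul_eq_mul_div,
        div_eq_iff (mul_ne_zero hc₁ hc₂)]
      linear_combination c₁ * d₂ * h + d₂ * x * ha₃ - d₂ * x * c₂ * h₁
    have hΛz := map_algebraMap_ne_zero (E := E) Λ hz
    rw [hψe, hRΛ, ← hq]
    field_simp
  · have hA : e / (x * D₁ : F) ≠ 0 := by
      rw [hee]
      exact div_ne_zero (div_ne_zero h3 (mul_ne_zero hc₁ hc₂)) (mul_ne_zero hx hD₁)
    simp only [sum_quadratic hE hψ hA, cuspidalKernel, if_neg h3, normFibreSum, Finset.mul_sum,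
      ← hq, ← hn]
    refine Finset.sum_congr rfl fun r _ => ?_
    by_cases h : Units.map (Algebra.norm F) r = n
    swap
    · simp only [if_neg h, mul_zero]
    simp only [if_pos h]
    have hNr : Algebra.norm F (r : E) = x * z * (D₁ * D₂) := by
      have := congrArg Units.val h
      simpa [hn] using this
    have hNβ : Algebra.norm F (β r) = c₁⁻¹ ^ 2 +
        Algebra.trace F E (r : E) * c₁⁻¹ * (c₂ * x * D₁)⁻¹ +
          (x * z * (D₁ * D₂)) * (c₂ * x * D₁)⁻¹ ^ 2 := by
      rw [← hNr]
      apply (algebraMap F E).injective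
      simp only [β, map_mul, map_add, map_pow, algebraMap_norm_eq hE, algebraMap_trace_eq hE,
        AlgHom.commutes]
      ring
    have hexp : a₁ * x / c₁ + d₂ * z / c₂ + -(Algebra.norm F (β r) / (e / (x * D₁))) =
        ((a₁ * a₂ + b₁ * c₂) * x + (c₁ * b₂ + d₁ * d₂) * z) / c₃ +
          -(Algebra.trace F E (r : E) / c₃) := by
      rw [hNβ, hee]
      field_simp
      rw [h₁, h₂, hc₃]
      ring
    have hψψ : ψ (a₁ * x / c₁ + d₂ * z / c₂) * ψ (-(Algebra.norm F (β r) / (e / (x * D₁)))) =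
        ψ (((a₁ * a₂ + b₁ * c₂) * x + (c₁ * b₂ + d₁ * d₂) * z) / c₃) *
          ψ (-(Algebra.trace F E (r : E) / c₃)) := by
      rw [← AddChar.map_add_eq_mul, ← AddChar.map_add_eq_mul, hexp]
    have hqq : q⁻¹ ^ 2 * q = q⁻¹ := by field_simp
    linear_combination (-(q⁻¹ ^ 2 * q) * (Λ (algebraMap F E z))⁻¹ * Λ r) * hψψ -
      ψ (((a₁ * a₂ + b₁ * c₂) * x + (c₁ * b₂ + d₁ * d₂) * z) / c₃) *
          ψ (-(Algebra.trace F E (r : E) / c₃)) * (Λ (algebraMap F E z))⁻¹ * Λ r * hqq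

open Classical in
theorem cuspidalKernel_one (ψ : AddChar F ℂ) (Λ : MulChar E ℂ) :
    Matrix.of (cuspidalKernel ψ Λ 1 0 0 1 1) = 1 := by
  ext x y
  simp only [cuspidalKernel, Matrix.of_apply, Matrix.one_apply, if_true, one_mul, map_one,
    zero_mul, zero_div, AddChar.map_zero_eq_one, Units.val_inj, eq_comm (a := y)]

open Classical in
/-- The cuspidal representation of `GL₂(F)` attached to a character `Λ` of `Eˣ` with `Λ^q ≠ Λ`,
realized on the complex functions on `Fˣ` (Kirillov model with respect to a nontrivial additive
character `ψ` of `F`). Its dimension is `q - 1`, and its isomorphism class does not depend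
on `ψ`. -/
noncomputable def cuspidalRep (hE : Module.finrank F E = 2) (ψ : AddChar F ℂ) (hψ : ψ ≠ 1)
    (Λ : MulChar E ℂ) (hΛ : Λ ^ Fintype.card F ≠ Λ) :
    Representation ℂ (Matrix.GeneralLinearGroup (Fin 2) F) (Fˣ → ℂ) where
  toFun g := Matrix.toLin' (Matrix.of (cuspidalKernel ψ Λ (g 0 0) (g 0 1) (g 1 0) (g 1 1)
    (Matrix.GeneralLinearGroup.det g)))
  map_one' := by
    simp [cuspidalKernel_one]
    rfl
  map_mul' g h := by
    have hg : ((Matrix.GeneralLinearGroup.det g : Fˣ) : F) = g 0 0 * g 1 1 - g 0 1 * g 1 0 :=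
      Matrix.det_fin_two _
    have hh : ((Matrix.GeneralLinearGroup.det h : Fˣ) : F) = h 0 0 * h 1 1 - h 0 1 * h 1 0 :=
      Matrix.det_fin_two _
    rw [Module.End.mul_eq_comp, ← Matrix.toLin'_mul]
    congr 1
    ext x z
    rw [Matrix.mul_apply]
    simp only [Matrix.of_apply, Units.val_mul, Matrix.mul_apply, Fin.sum_univ_two, map_mul]
    symm
    by_cases h1 : g 1 0 = 0
    · rw [h1, cuspidalKernel_mul_of_left hE ψ Λ (by rw [hg, h1]; ring) hh]
      simp
    · by_cases h2 : h 1 0 = 0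
      · rw [h2, cuspidalKernel_mul_of_right hE ψ Λ h1 (by rw [hh, h2]; ring)]
        simp
      · exact cuspidalKernel_mul_of_ne_zero hE hψ hΛ h1 h2 hg hh x z

end CuspidalRepresentation

section Averaging

variable {G : Type*} [Group G]

/-- The weighted average `(P_Φ f)(g) = |K|⁻¹ ∑_{k ∈ K} Φ(k)⁻¹ f(k g)` of a function `f` on a finite
group `G` with respect to a one-dimensional representation `Φ` of a subgroup `K`. -/
noncomputable def twistedAverage [Finite G] (K : Subgroup G) (Φ : K →* ℂˣ) (f : G → ℂ)
    (g : G) : ℂ :=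
  (Nat.card K : ℂ)⁻¹ * ∑ᶠ k : K, ((Φ k : ℂˣ) : ℂ)⁻¹ * f (k * g)

end Averaging

section Torus

variable {F E : Type*} [Field F] [Field E] [Algebra F E]

/-- `z ↦ m_z`: the matrix, in the `F`-basis `b` of `E`, of the multiplication by `z`. -/
noncomputable def torusHom (b : Module.Basis (Fin 2) F E) :
    Eˣ →* Matrix.GeneralLinearGroup (Fin 2) F :=
  Units.map (Algebra.leftMulMatrix b : E →* Matrix (Fin 2) (Fin 2) F)

theorem torusHom_injective (b : Module.Basis (Fin 2) F E) :
    Function.Injective (torusHom b) :=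
  Units.map_injective (Algebra.leftMulMatrix_injective b)

/-- The Coxeter torus `K` of `GL₂(F)`: all matrices `m_z`, `z ∈ Eˣ`. -/
noncomputable def torus (b : Module.Basis (Fin 2) F E) :
    Subgroup (Matrix.GeneralLinearGroup (Fin 2) F) :=
  (torusHom b).range

/-- The isomorphism `z ↦ m_z` of `Eˣ` with the Coxeter torus. -/
noncomputable def torusEquiv (b : Module.Basis (Fin 2) F E) : Eˣ ≃* torus b :=
  MonoidHom.ofInjective (torusHom_injective b)

/-- A character of `Eˣ`, seen as a character of the Coxeter torus: `m_z ↦ Φ(z)`. -/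
noncomputable def torusChar (b : Module.Basis (Fin 2) F E) (Φ : MulChar E ℂ) :
    torus b →* ℂˣ :=
  Φ.toUnitHom.comp (torusEquiv b).symm.toMonoidHom

/-- The restriction to `Fˣ` of a character of `Eˣ`. -/
noncomputable def restrictToBase (F : Type*) {E : Type*} [Field F] [Field E] [Algebra F E]
    (Φ : MulChar E ℂ) : Fˣ →* ℂˣ :=
  Φ.toUnitHom.comp (Units.map (algebraMap F E))

/-- The diagonal matrix `d(a, 1)`. -/
noncomputable def diagOne (a : Fˣ) : Matrix.GeneralLinearGroup (Fin 2) F :=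
  Matrix.GeneralLinearGroup.mkOfDetNeZero !![(a : F), 0; 0, 1] (by simp)

/-- `Γ_a`: all pairs `(z, w)` in `Eˣ × Eˣ` with `N(w) = a N(z)` and
`Tr(w) = 2⁻¹ (a + 1) Tr(z)`. -/
def normTraceSet (E : Type*) [Field E] [Algebra F E] (a : Fˣ) : Set (Eˣ × Eˣ) :=
  {p | Algebra.norm F (p.2 : E) = a * Algebra.norm F (p.1 : E) ∧
    Algebra.trace F E (p.2 : E) = 2⁻¹ * (a + 1) * Algebra.trace F E (p.1 : E)}

/-- `S^Φ_Λ(a) = -(q² - 1)⁻¹ ∑_{(z, w) ∈ Γ_a} Φ⁻¹(z) Λ(w)`. -/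
noncomputable def twistedSum [Fintype F] (Φ Λ : MulChar E ℂ) (a : Fˣ) : ℂ :=
  -((Fintype.card F : ℂ) ^ 2 - 1)⁻¹ *
    ∑ᶠ p ∈ normTraceSet E a, (Φ (p.1 : E))⁻¹ * Λ (p.2 : E)

/-- The twisted spherical function `ζ^Φ_Λ = P_Φ(χ_Λ)` of `GL₂(F)`, where `χ_Λ` is the character
of the cuspidal representation attached to `Λ`. -/
noncomputable def twistedSpherical [Fintype F] [Fintype E] (hE : Module.finrank F E = 2)
    (b : Module.Basis (Fin 2) F E) (ψ : AddChar F ℂ) (hψ : ψ ≠ 1)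
    (Φ Λ : MulChar E ℂ) (hΛ : Λ ^ Fintype.card F ≠ Λ) :
    Matrix.GeneralLinearGroup (Fin 2) F → ℂ :=
  twistedAverage (torus b) (torusChar b Φ) (cuspidalRep hE ψ hψ Λ hΛ).character

end Torus

end TwistedSpherical

/-! The equivariance uses only that `χ_Λ` is a class function. The value at `d(a, 1)` follows from a
uniform formula for the cuspidal character (`cuspidalRep_character`): `χ_Λ(g)` is minus the sum of
`Λ` over the elements of `Eˣ` whose norm is `det g` and whose trace is `tr g`, plus a correction `q
Λ(g)` when `g` is scalar. It comes from summing the Kirillov kernel along its diagonal;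
orthogonality of additive characters imposes the trace condition.

The basis is chosen so that both diagonal entries of `m_z` equal `Tr(z)/2`. Hence `m_z d(a, 1)` has
determinant `a N(z)` and trace `(a + 1) Tr(z)/2`, which are the two conditions defining `Γ_a`.
Averaging the main term over `z` therefore gives `S^Φ_Λ(a)`. The correction survives only for `a =
1` and `z ∈ Fˣ`, where orthogonality of `φ` and `λ` gives `q (q - 1)/(q² - 1) = q/(q + 1)` or `0`.
-/

namespace TwistedSpherical

/-! ### The character of the cuspidal representation. -/

section Character

variable {F E : Type*} [Field F] [Fintype F] [Field E] [Fintype E] [Algebra F E]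

open Classical in
/-- The sum of a nontrivial additive character, twisted by `e`, over the nonzero elements. -/
theorem sum_units_addChar {ψ : AddChar F ℂ} (hψ : ψ ≠ 1) (e : F) :
    ∑ x : Fˣ, ψ (x * e) = (if e = 0 then (Fintype.card F : ℂ) else 0) - 1 := by
  have h := AddChar.sum_mulShift (ψ := ψ) e (AddChar.IsPrimitive.of_ne_one hψ)
  rw [sum_eq_zero_add_units] at h
  simp only [zero_mul, AddChar.map_zero_eq_one, Nat.cast_ite, Nat.cast_zero] at h
  linear_combination h

open Classical in
/-- The sum of `Λ(s)` over all `s` in `Eˣ` of norm `n` and trace `t`. -/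
noncomputable def normTraceSum (Λ : MulChar E ℂ) (n t : F) : ℂ :=
  ∑ s : Eˣ, if Algebra.norm F (s : E) = n ∧ Algebra.trace F E (s : E) = t then Λ s else 0

/-- The elements of given norm and trace are the roots of a quadratic polynomial. -/
theorem eq_or_eq_of_norm_trace (hE : Module.finrank F E = 2) {a d : F} {s : E}
    (hn : Algebra.norm F s = a * d) (ht : Algebra.trace F E s = a + d) :
    a = d ∧ s = algebraMap F E a := by
  have h1 := algebraMap_norm_eq hE s
  have h2 := algebraMap_trace_eq hE s
  rw [hn, map_mul] at h1
  rw [ht, map_add] at h2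
  have h3 : (s - algebraMap F E a) * (s - algebraMap F E d) = 0 := by
    linear_combination h1 - s * h2
  rcases mul_eq_zero.1 h3 with h | h
  -- A root lying in `F` has trace twice itself, so the trace `a + d` forces `a = d`.
  · obtain rfl := sub_eq_zero.1 h
    rw [Algebra.trace_algebraMap, hE, two_smul] at ht
    exact ⟨add_left_cancel ht, rfl⟩
  · obtain rfl := sub_eq_zero.1 h
    rw [Algebra.trace_algebraMap, hE, two_smul] at ht
    obtain rfl := add_right_cancel ht
    exact ⟨rfl, rfl⟩

-- This lets upper triangular matrices obey the same character formula as the others: a split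
-- characteristic polynomial contributes only through a double root, which lies in `F`.
open Classical in
theorem normTraceSum_split (hE : Module.finrank F E = 2) (Λ : MulChar E ℂ) {a d : F}
    (ha : a ≠ 0) :
    normTraceSum Λ (a * d) (a + d) = if a = d then Λ (algebraMap F E a) else 0 := by
  unfold normTraceSum
  split_ifs with h
  · subst h
    let u : Eˣ := Units.map (algebraMap F E) (Units.mk0 a ha)
    have hu : (u : E) = algebraMap F E a := rfl
    rw [Finset.sum_eq_single u]
    · rw [if_pos, hu]
      rw [hu, Algebra.trace_algebraMap, Algebra.norm_algebraMap, hE, two_smul, sq]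
      exact ⟨rfl, rfl⟩
    · intro s _ hs
      rw [if_neg]
      rintro ⟨hn, ht⟩
      exact hs (Units.ext (eq_or_eq_of_norm_trace hE hn ht).2)
    · intro h; exact absurd (Finset.mem_univ _) h
  · refine Finset.sum_eq_zero fun s _ => if_neg ?_
    rintro ⟨hn, ht⟩
    exact h (eq_or_eq_of_norm_trace hE hn ht).1

-- Substituting `t = x s` in the fibre `N(t) = x² D` produces a factor `Λ(x)` that cancels the one
-- in the kernel, and leaves `x` only linearly in the exponent. The sum over `x` is then `q` on the
-- elements of trace `a + d`, minus `1` everywhere; the `-1` part sums `Λ` over a whole norm fibre,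
-- which vanishes by `sum_norm_fibre`.
open Classical in
theorem sum_cuspidalKernel_diag_of_ne_zero (hE : Module.finrank F E = 2) {ψ : AddChar F ℂ}
    (hψ : ψ ≠ 1) {Λ : MulChar E ℂ} (hΛ : Λ ^ Fintype.card F ≠ Λ) {a b c d : F} (hc : c ≠ 0)
    (D : Fˣ) :
    ∑ x : Fˣ, cuspidalKernel ψ Λ a b c d D x x = -normTraceSum Λ (D : F) (a + d) := by
  have hq : (Fintype.card F : ℂ) ≠ 0 := by exact_mod_cast Fintype.card_ne_zero
  have hterm : ∀ x : Fˣ, cuspidalKernel ψ Λ a b c d D x x =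
      ∑ s : Eˣ, if Units.map (Algebra.norm F) s = D then
        -(Fintype.card F : ℂ)⁻¹ * Λ s * ψ (x * ((a + d - Algebra.trace F E (s : E)) / c))
        else 0 := by
    intro x
    have hx := x.ne_zero
    -- Puts `c` in the form `u * c'` with `u = x`, as `normFibreSum_scale` requires.
    have hcx : c = (x : F) * (c / x) := by field_simp
    have hs := normFibreSum_scale hE ψ Λ (c / x) D (x * x * D) x (by rw [sq])
    rw [← hcx] at hs
    rw [cuspidalKernel, if_neg hc, hs, normFibreSum, Finset.mul_sum, Finset.mul_sum]
    refine Finset.sum_congr rfl fun s _ => ?_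
    split_ifs
    · have hΛx := map_algebraMap_ne_zero (E := E) Λ hx
      have he : x * ((a + d - Algebra.trace F E (s : E)) / c) =
          (a * x + d * x) / c + -(Algebra.trace F E (s : E) / (c / x)) := by
        field_simp
        ring
      rw [he, AddChar.map_add_eq_mul]
      field_simp
    · simp
  simp_rw [hterm]
  rw [Finset.sum_comm]
  -- The first term on the right is the trace condition; the second comes from the missing `x = 0`
  -- and disappears after summing over `s`.
  have hin : ∀ s : Eˣ, (∑ x : Fˣ, if Units.map (Algebra.norm F) s = D then
        -(Fintype.card F : ℂ)⁻¹ * Λ s * ψ (x * ((a + d - Algebra.trace F E (s : E)) / c))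
        else 0) =
      -(if Algebra.norm F (s : E) = D ∧ Algebra.trace F E (s : E) = a + d then Λ s else 0) +
        (Fintype.card F : ℂ)⁻¹ * (if Units.map (Algebra.norm F) s = D then Λ s else 0) := by
    intro s
    have hN : Units.map (Algebra.norm F) s = D ↔ Algebra.norm F (s : E) = D := by
      rw [Units.ext_iff]; rfl
    by_cases h : Algebra.norm F (s : E) = D
    · simp only [hN, h, if_true, true_and]
      rw [← Finset.mul_sum, sum_units_addChar hψ]
      have h0 : (a + d - Algebra.trace F E (s : E)) / c = 0 ↔
          Algebra.trace F E (s : E) = a + d := by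
        rw [div_eq_zero_iff, or_iff_left hc, sub_eq_zero, eq_comm]
      simp only [h0]
      split_ifs
      · field_simp
        ring
      · ring
    · simp [hN, h]
  simp_rw [hin]
  rw [Finset.sum_add_distrib, ← Finset.mul_sum, sum_norm_fibre hΛ D, Finset.sum_neg_distrib,
    normTraceSum, mul_zero, add_zero]

-- A diagonal entry of the kernel is nonzero only for `a = d`. The sum of `ψ(b x / a)` is then `q -
-- 1` or `-1` according as `b` vanishes; the `-1` is the norm-trace sum of the double root, the `q`
-- the scalar correction.
open Classical in
theorem sum_cuspidalKernel_diag_of_eq_zero (hE : Module.finrank F E = 2) {ψ : AddChar F ℂ}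
    (hψ : ψ ≠ 1) (Λ : MulChar E ℂ) {a b d : F} (ha : a ≠ 0) (D : Fˣ) :
    ∑ x : Fˣ, cuspidalKernel ψ Λ a b 0 d D x x =
      (if b = 0 ∧ a = d then (Fintype.card F : ℂ) * Λ (algebraMap F E a) else 0) -
        normTraceSum Λ (a * d) (a + d) := by
  rw [normTraceSum_split hE Λ ha]
  have h1 : ∀ x : Fˣ, d * x = a * x ↔ a = d := fun x => by
    rw [mul_left_inj' x.ne_zero, eq_comm]
  simp only [cuspidalKernel, if_true, h1]
  by_cases h : a = d
  · subst h
    have h2 : ∀ x : Fˣ, b * x / a = x * (b / a) := fun x => by ring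
    have h3 : b / a = 0 ↔ b = 0 := by rw [div_eq_zero_iff, or_iff_left ha]
    simp only [if_true, and_true, h2]
    rw [← Finset.mul_sum, sum_units_addChar hψ]
    simp only [h3]
    split_ifs <;> ring
  · simp [h]

open Classical in
/-- The character of the cuspidal representation attached to `Λ`. -/
theorem cuspidalRep_character (hE : Module.finrank F E = 2) {ψ : AddChar F ℂ} (hψ : ψ ≠ 1)
    {Λ : MulChar E ℂ} (hΛ : Λ ^ Fintype.card F ≠ Λ) (g : Matrix.GeneralLinearGroup (Fin 2) F) :
    (cuspidalRep hE ψ hψ Λ hΛ).character g =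
      (if g 1 0 = 0 ∧ g 0 1 = 0 ∧ g 0 0 = g 1 1 then
        (Fintype.card F : ℂ) * Λ (algebraMap F E (g 0 0)) else 0) -
      normTraceSum Λ (g 0 0 * g 1 1 - g 0 1 * g 1 0) (g 0 0 + g 1 1) := by
  have hD : ((Matrix.GeneralLinearGroup.det g : Fˣ) : F) = g 0 0 * g 1 1 - g 0 1 * g 1 0 :=
    Matrix.det_fin_two _
  have hchar : (cuspidalRep hE ψ hψ Λ hΛ).character g = ∑ x : Fˣ, cuspidalKernel ψ Λ
      (g 0 0) (g 0 1) (g 1 0) (g 1 1) (Matrix.GeneralLinearGroup.det g) x x := by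
    change LinearMap.trace ℂ (Fˣ → ℂ) (Matrix.toLin' _) = _
    rw [Matrix.trace_toLin'_eq]
    rfl
  rw [hchar]
  by_cases h : g 1 0 = 0
  · have ha : g 0 0 ≠ 0 := by
      intro h0
      exact (Matrix.GeneralLinearGroup.det g).ne_zero (by rw [hD, h, h0]; ring)
    simp only [h, sum_cuspidalKernel_diag_of_eq_zero hE hψ Λ ha, true_and, mul_zero, sub_zero]
  · rw [sum_cuspidalKernel_diag_of_ne_zero hE hψ hΛ h, hD]
    simp [h]

end Character

/-! ### Equivariance of twisted averages. -/

section TwistedAverageEquivariance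

variable {G : Type*} [Group G] [Finite G]

/-- The twisted average of a class function is equivariant on both sides. -/
theorem twistedAverage_mul_mul (K : Subgroup G) (Φ : K →* ℂˣ)
    {f : G → ℂ} (hf : ∀ g h, f (g * h) = f (h * g)) (k k' : K) (g : G) :
    twistedAverage K Φ f (k * g * k') = Φ k * twistedAverage K Φ f g * Φ k' := by
  unfold twistedAverage
  have key : ∑ᶠ h : K, ((Φ h : ℂˣ) : ℂ)⁻¹ * f (h * (k * g * k')) =
      ∑ᶠ h : K, ((Φ k : ℂˣ) : ℂ) * Φ k' * (((Φ h : ℂˣ) : ℂ)⁻¹ * f (h * g)) := by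
    -- Since `f` is a class function, `f (h k g k') = f (k' h k g)`; the substitution `h ↦ k' h k`
    -- changes `Φ(h)⁻¹` by the factor `Φ(k) Φ(k')`.
    refine finsum_eq_of_bijective (fun h : K => k' * h * k)
      ((Equiv.mulLeft k').trans (Equiv.mulRight k)).bijective fun h => ?_
    have h1 : f (h * (k * g * k')) = f (((k' * h * k : K) : G) * g) := by
      rw [← mul_assoc, hf]
      simp only [Subgroup.coe_mul, mul_assoc]
    rw [h1, map_mul, map_mul, Units.val_mul, Units.val_mul]
    have n1 := (Φ k).ne_zero
    have n2 := (Φ k').ne_zero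
    field_simp
  rw [key, ← mul_finsum]
  ring

end TwistedAverageEquivariance

/-! ### Matrices of the Coxeter torus and orthogonality on `Fˣ`. -/

section TorusMatrices

variable {F E : Type*} [Field F] [Field E] [Algebra F E]

theorem torusHom_apply (b : Module.Basis (Fin 2) F E) (z : Eˣ) (i j : Fin 2) :
    torusHom b z i j = Algebra.leftMulMatrix b (z : E) i j := rfl

theorem torusChar_torusEquiv (b : Module.Basis (Fin 2) F E) (Φ : MulChar E ℂ) (z : Eˣ) :
    ((torusChar b Φ (torusEquiv b z) : ℂˣ) : ℂ) = Φ z := by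
  simp [torusChar]

theorem coe_torusEquiv (b : Module.Basis (Fin 2) F E) (z : Eˣ) :
    ((torusEquiv b z : torus b) : Matrix.GeneralLinearGroup (Fin 2) F) = torusHom b z := rfl

theorem torusHom_mul_diagOne (b : Module.Basis (Fin 2) F E) (z : Eˣ) (a : Fˣ) (i : Fin 2) :
    (torusHom b z * diagOne a) i 0 = torusHom b z i 0 * a ∧
      (torusHom b z * diagOne a) i 1 = torusHom b z i 1 := by
  have h : ∀ j, (torusHom b z * diagOne a) i j =
      ((torusHom b z : Matrix (Fin 2) (Fin 2) F) * !![(a : F), 0; 0, 1]) i j := fun _ => rfl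
  simp [h, Matrix.mul_apply]

/-- The first column of `m_z` holds the coordinates of `z b₀`; dividing by `b₀` expresses `z`
through `b₁ / b₀`, the element assumed traceless later. -/
theorem eq_add_mul_of_leftMulMatrix (b : Module.Basis (Fin 2) F E) (z : E) :
    z = algebraMap F E (Algebra.leftMulMatrix b z 0 0) +
      algebraMap F E (Algebra.leftMulMatrix b z 1 0) * (b 1 / b 0) := by
  have h := b.sum_repr (z * b 0)
  rw [Fin.sum_univ_two] at h
  simp only [Algebra.leftMulMatrix_eq_repr_mul, Algebra.smul_def] at h ⊢
  have h0 := b.ne_zero 0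
  field_simp
  linear_combination -h

/-- In a basis with `Tr(b₁ / b₀) = 0` both diagonal entries of `m_z` are half the trace of `z`. -/
theorem leftMulMatrix_diag (hE : Module.finrank F E = 2) (b : Module.Basis (Fin 2) F E)
    (hb : Algebra.trace F E (b 1 / b 0) = 0) (z : E) :
    2 * Algebra.leftMulMatrix b z 0 0 = Algebra.trace F E z ∧
      2 * Algebra.leftMulMatrix b z 1 1 = Algebra.trace F E z := by
  have h1 : Algebra.trace F E z = 2 * Algebra.leftMulMatrix b z 0 0 := by
    conv_lhs => rw [eq_add_mul_of_leftMulMatrix b z]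
    rw [map_add, Algebra.trace_algebraMap, hE, ← Algebra.smul_def, map_smul, hb]
    simp
  -- The other diagonal entry is what remains of the matrix trace.
  have h2 := Algebra.trace_eq_matrix_trace b z
  rw [Matrix.trace_fin_two] at h2
  exact ⟨h1.symm, by linear_combination h1 - 2 * h2⟩

theorem norm_eq_leftMulMatrix (b : Module.Basis (Fin 2) F E) (z : E) :
    Algebra.norm F z = Algebra.leftMulMatrix b z 0 0 * Algebra.leftMulMatrix b z 1 1 -
      Algebra.leftMulMatrix b z 0 1 * Algebra.leftMulMatrix b z 1 0 := by
  rw [Algebra.norm_eq_matrix_det b, Matrix.det_fin_two]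

/-- `m_z d(a, 1)` is scalar if and only if `a = 1` and `z` lies in the base field. -/
theorem torusHom_mul_diagOne_scalar_iff (b : Module.Basis (Fin 2) F E) (z : Eˣ) (a : Fˣ) :
    ((torusHom b z * diagOne a) 1 0 = 0 ∧ (torusHom b z * diagOne a) 0 1 = 0 ∧
      (torusHom b z * diagOne a) 0 0 = (torusHom b z * diagOne a) 1 1) ↔
    a = 1 ∧ ∃ x : Fˣ, Units.map (algebraMap F E) x = z := by
  simp only [torusHom_mul_diagOne, torusHom_apply]
  constructor
  · rintro ⟨h1, -, h3⟩
    -- A vanishing lower left entry already forces `z` into `F`; then `m_z` is scalar, and comparing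
    -- diagonal entries gives `a = 1`.
    have h10 := (mul_eq_zero.1 h1).resolve_right a.ne_zero
    have hz := eq_add_mul_of_leftMulMatrix b (z : E)
    rw [h10, map_zero, zero_mul, add_zero] at hz
    set x := Algebra.leftMulMatrix b (z : E) 0 0 with hx
    have hx0 : x ≠ 0 := by
      intro h0
      rw [h0, map_zero] at hz
      exact z.ne_zero hz
    have h11 : Algebra.leftMulMatrix b (z : E) 1 1 = x := by
      rw [hz, AlgHom.commutes]
      simp [Matrix.algebraMap_matrix_apply]
    refine ⟨Units.ext ?_, Units.mk0 x hx0, Units.ext hz.symm⟩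
    rw [h11] at h3
    exact mul_left_cancel₀ hx0 (by rw [h3, Units.val_one, mul_one])
  · rintro ⟨rfl, x, rfl⟩
    have : ∀ i j, Algebra.leftMulMatrix b ((Units.map (algebraMap F E : F →* E) x : Eˣ) : E) i j =
        if i = j then (x : F) else 0 := by
      intro i j
      change Algebra.leftMulMatrix b (algebraMap F E x) i j = _
      rw [AlgHom.commutes, Matrix.algebraMap_matrix_apply]
      rfl
    simp only [this]
    simp

open Classical in
/-- Orthogonality of the restrictions to `Fˣ` of two characters of `Eˣ`. -/
theorem sum_restrictToBase [Fintype F] (Φ Λ : MulChar E ℂ) :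
    ∑ x : Fˣ, (Φ (algebraMap F E x))⁻¹ * Λ (algebraMap F E x) =
      if restrictToBase F Λ = restrictToBase F Φ then (Fintype.card F : ℂ) - 1 else 0 := by
  -- The summand is the single character `φ⁻¹ λ`, whose sum over the group is `q - 1` if it is
  -- trivial and `0` otherwise.
  let f : Fˣ →* ℂ := (Units.coeHom ℂ).comp ((restrictToBase F Φ)⁻¹ * restrictToBase F Λ)
  have hval : ∀ (Θ : MulChar E ℂ) (x : Fˣ),
      ((restrictToBase F Θ x : ℂˣ) : ℂ) = Θ (algebraMap F E x) := fun _ _ => rfl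
  have hf : f = 1 ↔ restrictToBase F Λ = restrictToBase F Φ := by
    rw [eq_comm (a := restrictToBase F Λ),
      ← inv_mul_eq_one (a := restrictToBase F Φ) (b := restrictToBase F Λ)]
    exact ⟨fun h => MonoidHom.ext fun x => Units.ext (DFunLike.congr_fun h x), fun h => by
      simp only [f, h]; rfl⟩
  have h := sum_hom_units f
  simp only [hf, Fintype.card_units, Nat.cast_ite, Nat.cast_zero,
    Nat.cast_sub (Fintype.card_pos (α := F)), Nat.cast_one] at h
  rw [← h]
  refine Finset.sum_congr rfl fun x _ => ?_
  simp [f, hval]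

end TorusMatrices

/-! ### The average over the torus and the main formula. -/

section MainFormula

variable {F E : Type*} [Field F] [Fintype F] [Field E] [Fintype E] [Algebra F E]

theorem card_torus (hE : Module.finrank F E = 2) (b : Module.Basis (Fin 2) F E) :
    (Nat.card (torus b) : ℂ) = (Fintype.card F : ℂ) ^ 2 - 1 := by
  classical
  rw [← Nat.card_congr (torusEquiv b).toEquiv, Nat.card_eq_fintype_card, Fintype.card_units,
    card_quadratic hE, Nat.cast_sub (Nat.one_le_pow _ _ Fintype.card_pos), Nat.cast_pow,
    Nat.cast_one]

-- Fibring `Γ_a` over its first coordinate exhibits the norm-trace sums that occur in the character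
-- of `m_z d(a, 1)`.
open Classical in
theorem twistedSum_eq (Φ Λ : MulChar E ℂ) (a : Fˣ) :
    twistedSum Φ Λ a = -((Fintype.card F : ℂ) ^ 2 - 1)⁻¹ *
      ∑ z : Eˣ, (Φ z)⁻¹ * normTraceSum Λ (a * Algebra.norm F (z : E))
        (2⁻¹ * (a + 1) * Algebra.trace F E (z : E)) := by
  rw [twistedSum, finsum_mem_def, finsum_eq_sum_of_fintype, Fintype.sum_prod_type]
  congr 1
  refine Finset.sum_congr rfl fun z _ => ?_
  rw [normTraceSum, Finset.mul_sum]
  refine Finset.sum_congr rfl fun w _ => ?_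
  rw [Set.indicator_apply, mul_ite, mul_zero]
  exact if_congr Iff.rfl rfl rfl

-- Right multiplication by `d(a, 1)` scales the first column of `m_z`, so the determinant becomes `a
-- N(z)` and the trace `(a + 1) Tr(z)/2`. Odd characteristic permits the division by `2`.
open Classical in
theorem cuspidalRep_character_torusHom_mul_diagOne (hF : ringChar F ≠ 2)
    (hE : Module.finrank F E = 2) (b : Module.Basis (Fin 2) F E)
    (hb : Algebra.trace F E (b 1 / b 0) = 0) {ψ : AddChar F ℂ} (hψ : ψ ≠ 1) {Λ : MulChar E ℂ}
    (hΛ : Λ ^ Fintype.card F ≠ Λ) (z : Eˣ) (a : Fˣ) :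
    (cuspidalRep hE ψ hψ Λ hΛ).character (torusHom b z * diagOne a) =
      (if a = 1 ∧ ∃ x : Fˣ, Units.map (algebraMap F E) x = z then
        (Fintype.card F : ℂ) * Λ z else 0) -
      normTraceSum Λ (a * Algebra.norm F (z : E))
        (2⁻¹ * (a + 1) * Algebra.trace F E (z : E)) := by
  have h2 : (2 : F) ≠ 0 := Ring.two_ne_zero hF
  obtain ⟨h00, h11⟩ := leftMulMatrix_diag hE b hb (z : E)
  rw [cuspidalRep_character]
  simp only [torusHom_mul_diagOne_scalar_iff]
  congr 1
  · refine if_ctx_congr Iff.rfl (fun h => ?_) fun _ => rfl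
    obtain ⟨rfl, x, rfl⟩ := h
    congr 2
    rw [(torusHom_mul_diagOne b _ 1 0).1, torusHom_apply]
    change algebraMap F E (Algebra.leftMulMatrix b (algebraMap F E x) 0 0 * _) = algebraMap F E x
    rw [AlgHom.commutes]
    simp [Matrix.algebraMap_matrix_apply]
  · simp only [torusHom_mul_diagOne, torusHom_apply]
    congr 1
    · rw [norm_eq_leftMulMatrix b]; ring
    · apply mul_left_cancel₀ h2
      field_simp
      linear_combination (a : F) * h00 + h11

open Classical in
theorem twistedSpherical_diagOne (hF : ringChar F ≠ 2) (hE : Module.finrank F E = 2)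
    (b : Module.Basis (Fin 2) F E) (hb : Algebra.trace F E (b 1 / b 0) = 0)
    (ψ : AddChar F ℂ) (hψ : ψ ≠ 1) (Φ Λ : MulChar E ℂ) (hΛ : Λ ^ Fintype.card F ≠ Λ) (a : Fˣ) :
    twistedSpherical hE b ψ hψ Φ Λ hΛ (diagOne a) =
      twistedSum Φ Λ a + (Fintype.card F : ℂ) * ((Fintype.card F : ℂ) + 1)⁻¹ *
        (if a = 1 then 1 else 0) *
        (if restrictToBase F Λ = restrictToBase F Φ then 1 else 0) := by
  have hsum : ∑ᶠ k : torus b, ((torusChar b Φ k : ℂˣ) : ℂ)⁻¹ *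
        (cuspidalRep hE ψ hψ Λ hΛ).character (k * diagOne a) =
      ∑ z : Eˣ, (Φ z)⁻¹ *
        (cuspidalRep hE ψ hψ Λ hΛ).character (torusHom b z * diagOne a) := by
    rw [← finsum_eq_sum_of_fintype]
    refine (finsum_eq_of_bijective _ (torusEquiv b).bijective fun z => ?_).symm
    rw [torusChar_torusEquiv, coe_torusEquiv]
  -- The scalar correction is supported on the image of `Fˣ` in `Eˣ`, so its sum reduces to
  -- orthogonality of `φ` and `λ`.
  have hscalar : ∑ z : Eˣ, (Φ z)⁻¹ * (if a = 1 ∧ ∃ x : Fˣ, Units.map (algebraMap F E) x = z then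
        (Fintype.card F : ℂ) * Λ z else 0) =
      (Fintype.card F : ℂ) * (if a = 1 then 1 else 0) *
        (if restrictToBase F Λ = restrictToBase F Φ then (Fintype.card F : ℂ) - 1 else 0) := by
    by_cases h : a = 1
    swap
    · simp [h]
    simp only [h, true_and, if_true, mul_one]
    rw [← sum_restrictToBase, Finset.mul_sum]
    have hinj : Function.Injective (Units.map (algebraMap F E : F →* E)) :=
      Units.map_injective (algebraMap F E).injective
    simp only [mul_ite, mul_zero]
    rw [← Finset.sum_filter]
    symm
    refine Finset.sum_bij (fun x _ => Units.map (algebraMap F E : F →* E) x)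
      (fun x _ => Finset.mem_filter.2 ⟨Finset.mem_univ _, x, rfl⟩) (fun x _ y _ h => hinj h)
      (fun z hz => ?_) (fun x _ => ?_)
    · obtain ⟨x, hx⟩ := (Finset.mem_filter.1 hz).2
      exact ⟨x, Finset.mem_univ _, hx⟩
    · change _ = (Φ (algebraMap F E x))⁻¹ * (_ * Λ (algebraMap F E x))
      ring
  have hq : 1 < (Fintype.card F : ℝ) := by exact_mod_cast Fintype.one_lt_card
  have hq1 : (Fintype.card F : ℂ) - 1 ≠ 0 := by
    rw [sub_ne_zero]; exact_mod_cast hq.ne'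
  have hq2 : (Fintype.card F : ℂ) + 1 ≠ 0 := by exact_mod_cast Nat.succ_ne_zero (Fintype.card F)
  -- The factor `q - 1` from orthogonality cancels against `|K| = (q - 1)(q + 1)`, leaving `q/(q +
  -- 1)`.
  have hq3 : (Fintype.card F : ℂ) ^ 2 - 1 =
      ((Fintype.card F : ℂ) - 1) * ((Fintype.card F : ℂ) + 1) := by ring
  rw [twistedSpherical, twistedAverage, hsum, card_torus hE]
  simp_rw [cuspidalRep_character_torusHom_mul_diagOne hF hE b hb hψ hΛ, mul_sub]
  rw [Finset.sum_sub_distrib, hscalar, twistedSum_eq, hq3]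
  split_ifs <;> field_simp <;> ring

end MainFormula

end TwistedSpherical

open TwistedSpherical in
open Classical in
theorem mainTheorem3 {F E : Type*} [Field F] [Fintype F] [Field E] [Fintype E] [Algebra F E]
    (hF : ringChar F ≠ 2) (hE : Module.finrank F E = 2)
    (b : Module.Basis (Fin 2) F E) (hb : Algebra.trace F E (b 1 / b 0) = 0)
    (ψ : AddChar F ℂ) (hψ : ψ ≠ 1)
    (Φ Λ : MulChar E ℂ) (hΛ : Λ ^ Fintype.card F ≠ Λ) :
    (∀ (k k' : torus b) (g : Matrix.GeneralLinearGroup (Fin 2) F),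
      twistedSpherical hE b ψ hψ Φ Λ hΛ (k * g * k') =
        torusChar b Φ k * twistedSpherical hE b ψ hψ Φ Λ hΛ g * torusChar b Φ k') ∧
    ∀ a : Fˣ,
      twistedSpherical hE b ψ hψ Φ Λ hΛ (diagOne a) =
        twistedSum Φ Λ a +
          (Fintype.card F : ℂ) * ((Fintype.card F : ℂ) + 1)⁻¹ *
            (if a = 1 then 1 else 0) *
            (if restrictToBase F Λ = restrictToBase F Φ then 1 else 0) := by
  exact ⟨fun k k' g => twistedAverage_mul_mul _ _
      (fun g h => Representation.char_mul_comm _ h g) k k' g,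
    fun a => twistedSpherical_diagOne hF hE b hb ψ hψ Φ Λ hΛ a⟩
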